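/- A pair $(G,H)$ consisting of a locally compact group $G$ and a subgroup $H$ is called a discrete Hecke pair if $H$ is open in $G$ and every double coset $HgH$ ($g\in G$) is a union of finitely many left cosets of $H$. If $H$ is a closed subgroup of a locally compact group $G$, the pair $(G,H)$ is called amenable ($H$ is co-amenable in $G$) if it has the fixed point property: whenever $G$ acts continuously by affine transformations on a compact convex subset $Q$ of a Hausdorff locally convex topological vector space (continuity meaning that $G\times Q\to Q$, $(g,q)\mapsto gq$, is continuous) and the restriction of this action to $H$ has a fixed point in $Q$, the action of $G$ has a fixed point in $Q$. Theorem. Let $(G,H)$ be a discrete Hecke pair and let $\Gamma$ be a closed subgroup of $G$ containing $H$. If the pair $(G,H)$ is amenable, then the pair $(\Gamma,H)$ is amenable as well. -/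

import Mathlib

open scoped Pointwise

universe u v

/-- `H` is a Hecke subgroup of `G`: every double coset `H g H` is a union of finitely many
left cosets `x H`. -/
def IsHeckeSubgroup {G : Type u} [Group G] (H : Subgroup G) : Prop :=
  ∀ g : G, ∃ F : Set G, F.Finite ∧
    DoubleCoset.doubleCoset g (H : Set G) (H : Set G) = ⋃ x ∈ F, x • (H : Set G)

/-- `(G, H)` is a discrete Hecke pair: `H` is an open subgroup of the topological group `G`
which is also a Hecke subgroup. -/
structure IsDiscreteHeckePair {G : Type u} [Group G] [TopologicalSpace G]
    (H : Subgroup G) : Prop where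
  isOpen : IsOpen (H : Set G)
  isHecke : IsHeckeSubgroup H

/-- An action of `G` on a subset `Q` of a real vector space is by affine transformations:
each `g` respects those convex combinations of points of `Q` that lie in `Q` (for convex `Q`,
all of them). -/
def IsAffineAction (G : Type u) [Group G] {E : Type v} [AddCommGroup E] [Module ℝ E]
    (Q : Set E) [MulAction G Q] : Prop :=
  ∀ (g : G) (x y z : Q) (a b : ℝ), 0 ≤ a → 0 ≤ b → a + b = 1 →
    (z : E) = a • (x : E) + b • (y : E) →
    ((g • z : Q) : E) = a • ((g • x : Q) : E) + b • ((g • y : Q) : E)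

/-- The pair `(G, H)` is amenable, i.e. it has the fixed point property (FP): whenever `G` acts
continuously (as a map `G × Q → Q`) by affine transformations on a compact convex subset `Q` of a
(Hausdorff) locally convex topological vector space `E`, and the restriction of the action to `H`
has a fixed point, then the action of `G` has a fixed point.

The universe of the spaces `E` is the second universe parameter `v`. -/
def IsAmenablePair {G : Type u} [Group G] [TopologicalSpace G] (H : Subgroup G) : Prop :=
  ∀ (E : Type v) [AddCommGroup E] [Module ℝ E] [TopologicalSpace E] [IsTopologicalAddGroup E]
    [ContinuousSMul ℝ E] [LocallyConvexSpace ℝ E] [T2Space E] (Q : Set E),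
    IsCompact Q → Convex ℝ Q →
    ∀ [MulAction G Q] [ContinuousSMul G Q], IsAffineAction G Q →
      (∃ q : Q, ∀ h ∈ H, h • q = q) → ∃ q : Q, ∀ g : G, g • q = q

/-! Co-amenability of `H` yields a `G`-invariant mean `m` on `G ⧸ H`. Given a `Γ`-space `Q` with an
`H`-fixed point `q₀`, it is enough to find a `Γ`-equivariant map `φ : G ⧸ H → Q`: the barycentre of
the image of `m` under `φ` is then fixed by `Γ`. The orbit map of `q₀` gives `φ` only on `Γ ⧸ H`. On
the other `Γ`-orbits, the stabilizer of `gH` is `Γ ∩ gHg⁻¹`. The Hecke condition makes its orbit at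
`q₀` finite, and the average of that orbit is a fixed point to which `gH` can be sent. Since `H` is
open, so is `Γ`; hence continuous functions on `Q` pull back along `φ` to functions in the domain of
`m`. -/

open Filter Topology

/-! ### Invariant means on `G`-sets -/

section Means

variable {G : Type*} [Group G] [TopologicalSpace G] {X : Type*} [MulAction G X]

/-- Bounded functions on a `G`-set which are uniformly continuous along the action. -/
def IsBoundedUniform (G : Type*) [Group G] [TopologicalSpace G] {X : Type*} [MulAction G X]
    (f : X → ℝ) : Prop :=
  (∃ C, ∀ x, |f x| ≤ C) ∧ ∀ ε > 0, ∀ᶠ g in 𝓝 (1 : G), ∀ x, |f (g • x) - f x| < ε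

/-- The type of bounded functions which are uniformly continuous along the action. -/
abbrev BoundedUniform (G : Type*) [Group G] [TopologicalSpace G] (X : Type*) [MulAction G X] :=
  {f : X → ℝ // IsBoundedUniform G f}

/-- Translation of a bounded uniformly continuous function. -/
def BoundedUniform.translate [IsTopologicalGroup G] (g : G) (f : BoundedUniform G X) :
    BoundedUniform G X :=
  ⟨fun x => f.1 (g • x), by
    obtain ⟨⟨C, hC⟩, hf⟩ := f.2
    refine ⟨⟨C, fun x => hC _⟩, fun ε hε => ?_⟩
    have ht : Tendsto (fun k : G => g * k * g⁻¹) (𝓝 1) (𝓝 1) := by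
      have : Continuous fun k : G => g * k * g⁻¹ := by fun_prop
      simpa using this.tendsto 1
    filter_upwards [ht.eventually (hf ε hε)] with k hk x
    simpa [mul_smul] using hk (g • x)⟩

/-- Evaluation at a point, as a functional on bounded uniformly continuous functions. -/
def evalMean (G : Type*) [Group G] [TopologicalSpace G] {X : Type*} [MulAction G X] (x : X) :
    BoundedUniform G X → ℝ := fun f => f.1 x

/-- The means on bounded uniformly continuous functions: the closed convex hull of the
evaluations, for the topology of pointwise convergence. -/
def means (G : Type*) [Group G] [TopologicalSpace G] (X : Type*) [MulAction G X] :
    Set (BoundedUniform G X → ℝ) :=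
  closure (convexHull ℝ (Set.range (evalMean G (X := X))))

/-- A closed convex set containing the evaluations contains all means. -/
theorem means_subset {S : Set (BoundedUniform G X → ℝ)} (hc : IsClosed S) (hS : Convex ℝ S)
    (h : ∀ x, evalMean G x ∈ S) : means G X ⊆ S :=
  closure_minimal (convexHull_min (Set.range_subset_iff.2 h) hS) hc

theorem evalMean_mem_means (x : X) : evalMean G x ∈ means G X :=
  subset_closure (subset_convexHull ℝ _ ⟨x, rfl⟩)

theorem convex_means : Convex ℝ (means G X) := (convex_convexHull ℝ _).closure

/-- A product of intervals containing all means. -/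
theorem exists_compact_convex_box : ∃ B : Set (BoundedUniform G X → ℝ), IsCompact B ∧
    Convex ℝ B ∧ ∀ x, evalMean G x ∈ B := by
  choose C hC using fun f : BoundedUniform G X => f.2.1
  refine ⟨Set.univ.pi fun f => Set.Icc (-C f) (C f), isCompact_univ_pi fun _ => isCompact_Icc,
    convex_pi fun _ _ => convex_Icc _ _, fun x f _ => ?_⟩
  exact abs_le.1 (hC f x)

theorem isCompact_means : IsCompact (means G X) := by
  obtain ⟨B, hB, hBc, hx⟩ := exists_compact_convex_box (G := G) (X := X)
  exact hB.of_isClosed_subset isClosed_closure (means_subset hB.isClosed hBc hx)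

theorem abs_mean_sub_le {m : BoundedUniform G X → ℝ} (hm : m ∈ means G X)
    (f f' : BoundedUniform G X) {ε : ℝ} (h : ∀ x, |f.1 x - f'.1 x| ≤ ε) : |m f - m f'| ≤ ε := by
  let L : (BoundedUniform G X → ℝ) →L[ℝ] ℝ :=
    ContinuousLinearMap.proj (R := ℝ) (φ := fun _ => ℝ) f -
      ContinuousLinearMap.proj (R := ℝ) (φ := fun _ => ℝ) f'
  have : means G X ⊆ L ⁻¹' Set.Icc (-ε) ε := by
    refine means_subset (isClosed_Icc.preimage L.continuous)
      ((convex_Icc _ _).linear_preimage L.toLinearMap) fun x => ?_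
    exact abs_le.1 (h x)
  exact abs_le.2 (this hm)

variable [IsTopologicalGroup G]

theorem translate_mem_means (g : G) {m : BoundedUniform G X → ℝ} (hm : m ∈ means G X) :
    (fun f => m (f.translate g)) ∈ means G X := by
  let L : (BoundedUniform G X → ℝ) →L[ℝ] (BoundedUniform G X → ℝ) :=
    ContinuousLinearMap.pi fun f =>
      ContinuousLinearMap.proj (R := ℝ) (φ := fun _ => ℝ) (f.translate g)
  have : means G X ⊆ L ⁻¹' means G X := by
    refine means_subset (isClosed_closure.preimage L.continuous)
      (convex_means.linear_preimage L.toLinearMap) fun x => ?_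
    exact evalMean_mem_means (g • x)
  exact this hm

instance : MulAction G (means G X) where
  smul g m := ⟨fun f => m.1 (f.translate g), translate_mem_means g m.2⟩
  one_smul m := by
    refine Subtype.ext (funext fun f => congrArg m.1 (Subtype.ext (funext fun x => ?_)))
    exact congrArg f.1 (one_smul G x)
  mul_smul g h m := by
    refine Subtype.ext (funext fun f => congrArg m.1 (Subtype.ext (funext fun x => ?_)))
    exact congrArg f.1 (mul_smul g h x)

instance : ContinuousSMul G (means G X) where
  continuous_smul := by
    refine Continuous.subtype_mk (continuous_pi fun f => ?_) _
    refine continuous_iff_continuousAt.2 fun ⟨g₀, m₀⟩ => ?_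
    refine Metric.tendsto_nhds.2 fun ε hε => ?_
    have ht : Tendsto (fun p : G × means G X => p.1 * g₀⁻¹) (𝓝 (g₀, m₀)) (𝓝 1) := by
      have : Continuous fun p : G × means G X => p.1 * g₀⁻¹ := by fun_prop
      simpa using this.tendsto (g₀, m₀)
    -- Uniformity of `f` bounds the effect of moving the group element for all means at once; moving
    -- the mean is then tested on the single function `f.translate g₀`.
    have h₁ := ht.eventually (f.2.2 (ε / 2) (half_pos hε))
    have hc : Continuous fun p : G × means G X => p.2.1 (f.translate g₀) :=
      (continuous_apply _).comp (continuous_subtype_val.comp continuous_snd)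
    have h₂ := Metric.tendsto_nhds.1 (hc.tendsto (g₀, m₀)) (ε / 2) (half_pos hε)
    filter_upwards [h₁, h₂] with p hp₁ hp₂
    have h₃ : |p.2.1 (f.translate p.1) - p.2.1 (f.translate g₀)| ≤ ε / 2 := by
      refine abs_mean_sub_le p.2.2 _ _ fun x => ?_
      simpa [mul_smul, BoundedUniform.translate] using (hp₁ (g₀ • x)).le
    rw [Real.dist_eq] at hp₂
    change dist (p.2.1 (f.translate p.1)) (m₀.1 (f.translate g₀)) < ε
    rw [Real.dist_eq]
    calc _ ≤ _ := abs_sub_le _ (p.2.1 (f.translate g₀)) _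
      _ < ε := by linarith

theorem isAffineAction_means : IsAffineAction G (means G X) := by
  intro g x y z a b _ _ _ h
  funext f
  exact congrFun h (f.translate g)

end Means

/-- A co-amenable subgroup admits an invariant mean on the coset space. -/
theorem IsAmenablePair.exists_invariant_mean {G : Type u} [Group G] [TopologicalSpace G]
    [IsTopologicalGroup G] {H : Subgroup G} (hH : IsAmenablePair.{u, u} H) :
    ∃ m ∈ means G (G ⧸ H), ∀ (g : G) (f : BoundedUniform G (G ⧸ H)), m (f.translate g) = m f := by
  have hfix : ∀ h ∈ H, h • (⟨_, evalMean_mem_means ((1 : G) : G ⧸ H)⟩ : means G (G ⧸ H)) =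
      ⟨_, evalMean_mem_means ((1 : G) : G ⧸ H)⟩ := by
    intro h hh
    refine Subtype.ext (funext fun f => congrArg f.1 ?_)
    change ((h * 1 : G) : G ⧸ H) = _
    exact QuotientGroup.eq.2 (by simpa using hh)
  obtain ⟨m, hm⟩ := hH _ (means G (G ⧸ H)) isCompact_means convex_means isAffineAction_means
    ⟨_, hfix⟩
  exact ⟨m.1, m.2, fun g f => congrFun (congrArg Subtype.val (hm g)) f⟩

/-! ### Barycentres -/

section Barycentre

variable {G : Type*} [Group G] [TopologicalSpace G] {X : Type*} [MulAction G X]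
  {E : Type*} [AddCommGroup E] [Module ℝ E] [TopologicalSpace E] {Q : Set E}

/-- The image of a mean under a map to a compact convex set has a barycentre, which is compatible
with all continuous affine functions. -/
theorem exists_barycentre [IsTopologicalAddGroup E] [ContinuousSMul ℝ E] [T2Space E]
    (hQ : IsCompact Q) (hQc : Convex ℝ Q) (φ : X → Q)
    {m : BoundedUniform G X → ℝ} (hm : m ∈ means G X) :
    ∃ q : Q, ∀ (b : Q → ℝ) (_ : Continuous b)
      (_ : ∀ (x y z : Q) (s t : ℝ), 0 ≤ s → 0 ≤ t → s + t = 1 →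
        (z : E) = s • (x : E) + t • (y : E) → b z = s * b x + t * b y)
      (f : BoundedUniform G X), (∀ x, f.1 x = b (φ x)) → m f = b q := by
  obtain ⟨B, hB, hBc, hx⟩ := exists_compact_convex_box (G := G) (X := X)
  -- Pairing each evaluation with its point of `Q` makes the same convex combinations approximate
  -- both `m` and `q`; compactness of the closed hull provides `q`.
  let R : Set ((BoundedUniform G X → ℝ) × E) := Set.range fun x => (evalMean G x, (φ x : E))
  let K := closure (convexHull ℝ R)
  have hK : IsCompact K := by
    refine (hB.prod hQ).of_isClosed_subset isClosed_closure
      (closure_minimal (convexHull_min ?_ (hBc.prod hQc)) (hB.prod hQ).isClosed)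
    rintro _ ⟨x, rfl⟩
    exact ⟨hx x, (φ x).2⟩
  have hmK : m ∈ Prod.fst '' K := by
    refine means_subset (hK.image continuous_fst).isClosed ?_ (fun x => ?_) hm
    · exact ((convex_convexHull ℝ R).closure).linear_image (LinearMap.fst ℝ _ _)
    · exact ⟨_, subset_closure (subset_convexHull ℝ R ⟨x, rfl⟩), rfl⟩
  obtain ⟨⟨m', q⟩, hq, rfl⟩ := hmK
  have hqQ : q ∈ Q := by
    have : K ⊆ Prod.snd ⁻¹' Q := by
      refine closure_minimal (convexHull_min ?_ (hQc.linear_preimage (LinearMap.snd ℝ _ _)))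
        (hQ.isClosed.preimage continuous_snd)
      rintro _ ⟨x, rfl⟩
      exact (φ x).2
    exact this hq
  refine ⟨⟨q, hqQ⟩, fun b hb hba f hf => ?_⟩
  let T : Set ((BoundedUniform G X → ℝ) × E) := {p | ∃ h : p.2 ∈ Q, p.1 f = b ⟨p.2, h⟩}
  have hT : IsClosed T := by
    have he : IsClosedEmbedding (Prod.map id Subtype.val :
        (BoundedUniform G X → ℝ) × Q → (BoundedUniform G X → ℝ) × E) :=
      IsClosedEmbedding.id.prodMap hQ.isClosed.isClosedEmbedding_subtypeVal
    have hc : IsClosed {p : (BoundedUniform G X → ℝ) × Q | p.1 f = b p.2} :=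
      isClosed_eq ((continuous_apply f).comp continuous_fst) (hb.comp continuous_snd)
    convert he.isClosedMap _ hc using 1
    ext ⟨p, y⟩
    constructor
    · rintro ⟨h, h'⟩
      exact ⟨(p, ⟨y, h⟩), h', rfl⟩
    · rintro ⟨⟨p', y'⟩, h', h⟩
      obtain ⟨rfl, rfl⟩ := Prod.mk.inj h
      exact ⟨y'.2, h'⟩
  have hTc : Convex ℝ T := by
    rintro ⟨p, y⟩ ⟨h, h'⟩ ⟨p', y'⟩ ⟨k, k'⟩ s t hs ht hst
    refine ⟨hQc h k hs ht hst, ?_⟩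
    rw [hba ⟨y, h⟩ ⟨y', k⟩ _ s t hs ht hst rfl, ← h', ← k']
    rfl
  have hKT : K ⊆ T := by
    refine closure_minimal (convexHull_min ?_ hTc) hT
    rintro _ ⟨x, rfl⟩
    exact ⟨(φ x).2, hf x⟩
  exact (hKT hq).2

end Barycentre

/-! ### Fixed points and equivariant maps -/

section FixedPoints

variable {Γ : Type*} [Group Γ] {E : Type*} [AddCommGroup E] [Module ℝ E] {Q : Set E}
  [MulAction Γ Q]

/-- Affine actions respect finite convex combinations. -/
theorem IsAffineAction.smul_sum (hQ : Convex ℝ Q) (hA : IsAffineAction Γ Q) (g : Γ) {ι : Type*}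
    (s : Finset ι) (w : ι → ℝ) (hw : ∀ i ∈ s, 0 ≤ w i) (hw₁ : ∑ i ∈ s, w i = 1) (x : ι → Q)
    (z : Q) (hz : (z : E) = ∑ i ∈ s, w i • (x i : E)) :
    ((g • z : Q) : E) = ∑ i ∈ s, w i • ((g • x i : Q) : E) := by
  -- The graph of an affine map is convex.
  let T : Set (E × E) := {p | ∃ h : p.1 ∈ Q, p.2 = (g • (⟨p.1, h⟩ : Q) : Q)}
  have hT : Convex ℝ T := by
    rintro ⟨p, y⟩ ⟨h, h'⟩ ⟨p', y'⟩ ⟨k, k'⟩ s t hs ht hst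
    refine ⟨hQ h k hs ht hst, ?_⟩
    rw [hA g ⟨p, h⟩ ⟨p', k⟩ _ s t hs ht hst rfl, ← h', ← k']
    rfl
  obtain ⟨h, h'⟩ := hT.sum_mem (z := fun i => ((x i : E), ((g • x i : Q) : E))) hw hw₁
    fun i _ => ⟨(x i).2, rfl⟩
  simp only [Prod.fst_sum, Prod.snd_sum, Prod.smul_mk] at h h'
  rw [h']
  congr 3
  exact Subtype.ext hz

/-- A group with a finite orbit in a convex set has a fixed point. -/
theorem IsAffineAction.exists_fixed_of_finite_orbit (hQ : Convex ℝ Q) (hA : IsAffineAction Γ Q)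
    (L : Subgroup Γ) (q : Q) (hfin : (MulAction.orbit L q).Finite) :
    ∃ p : Q, ∀ l ∈ L, l • p = p := by
  classical
  let S : Finset Q := hfin.toFinset
  have hne : S.Nonempty := ⟨q, by simp [S]⟩
  have hcard : (S.card : ℝ) ≠ 0 := by exact_mod_cast hne.card_pos.ne'
  have hw₁ : ∑ _ ∈ S, (S.card : ℝ)⁻¹ = 1 := by simp [hcard]
  have hw : ∀ i ∈ S, 0 ≤ (S.card : ℝ)⁻¹ := fun _ _ => by positivity
  have hmem := hQ.sum_mem (z := fun i : Q => (i : E)) hw hw₁ fun i _ => i.2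
  refine ⟨⟨_, hmem⟩, fun l hl => Subtype.ext ?_⟩
  rw [hA.smul_sum hQ l S (fun _ => (S.card : ℝ)⁻¹) hw hw₁ (fun i => i) _ rfl]
  refine Finset.sum_bijective (fun x => l • x) (MulAction.bijective l) (fun i => ?_)
    fun i _ => rfl
  simp only [S, Set.Finite.mem_toFinset]
  rw [← MulAction.orbit_eq_iff, ← MulAction.orbit_eq_iff,
    ← MulAction.orbit_smul (⟨l, hl⟩ : L) i]
  rfl

/-- If point stabilizers of one action have fixed points in another, then there is an equivariant
map between the two. -/
theorem exists_equivariant_map {Γ X Y : Type*} [Group Γ] [MulAction Γ X] [MulAction Γ Y]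
    (h : ∀ x : X, ∃ y : Y, ∀ g ∈ MulAction.stabilizer Γ x, g • y = y) :
    ∃ φ : X → Y, ∀ (g : Γ) (x : X), φ (g • x) = g • φ x := by
  choose p hp using h
  let r : X → X := fun x => (Quotient.mk (MulAction.orbitRel Γ X) x).out
  have hr : ∀ x, ∃ g : Γ, g • r x = x := fun x =>
    (MulAction.orbitRel Γ X).symm (Quotient.mk_out (s := MulAction.orbitRel Γ X) x)
  have hrg : ∀ (g : Γ) x, r (g • x) = r x := fun g x =>
    congrArg Quotient.out (Quotient.sound (s := MulAction.orbitRel Γ X) ⟨g, rfl⟩)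
  choose c hc using hr
  refine ⟨fun x => c x • p (r x), fun g x => ?_⟩
  -- Two elements carrying the representative to the same point differ by its stabilizer, which
  -- fixes `p (r x)`.
  have hs : (c (g • x))⁻¹ * (g * c x) ∈ MulAction.stabilizer Γ (r x) := by
    rw [MulAction.mem_stabilizer_iff, mul_smul, mul_smul, hc, inv_smul_eq_iff]
    conv_rhs => rw [← hrg g x, hc]
  have := hp (r x) _ hs
  rw [mul_smul, inv_smul_eq_iff, mul_smul] at this
  simp only [hrg]
  exact this.symm

end FixedPoints

/-! ### The Hecke condition and the main theorem -/

/-- For a Hecke subgroup `H`, the `H`-orbits in the coset space are finite. -/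
theorem IsHeckeSubgroup.finite_orbit {G : Type*} [Group G] {H : Subgroup G}
    (hH : IsHeckeSubgroup H) (g : G) : {x : G ⧸ H | ∃ h ∈ H, x = ((h * g : G) : G ⧸ H)}.Finite := by
  obtain ⟨F, hF, h⟩ := hH g
  refine (hF.image fun x : G => (x : G ⧸ H)).subset ?_
  rintro _ ⟨k, hk, rfl⟩
  have : k * g ∈ DoubleCoset.doubleCoset g (H : Set G) (H : Set G) :=
    DoubleCoset.mem_doubleCoset.2 ⟨k, hk, 1, H.one_mem, by simp⟩
  rw [h] at this
  simp only [Set.mem_iUnion] at this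
  obtain ⟨x, hx, y, hy, hxy⟩ := this
  refine ⟨x, hx, QuotientGroup.eq.2 ?_⟩
  have : x⁻¹ * (k * g) = y := by rw [← hxy]; simp
  rwa [this]

/-- If `H` is a Hecke subgroup contained in `Γ` and fixes a point `q`, then the stabilizers in `Γ`
of points of `G ⧸ H` have finite orbits at `q`. -/
theorem IsHeckeSubgroup.finite_stabilizer_orbit {G Y : Type*} [Group G] {H Γ : Subgroup G}
    (hH : IsHeckeSubgroup H) [MulAction Γ Y] {q : Y}
    (hq : ∀ h ∈ H.subgroupOf Γ, h • q = q) (x : G ⧸ H) :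
    (MulAction.orbit (MulAction.stabilizer Γ x) q).Finite := by
  classical
  obtain ⟨g, rfl⟩ := QuotientGroup.mk_surjective x
  -- An element `l` of the stabilizer lies in `gHg⁻¹`, so its coset `lH` lies in `g • (Hg⁻¹H / H)`.
  let A : Set (G ⧸ H) := (fun x => g • x) '' {x | ∃ h ∈ H, x = ((h * g⁻¹ : G) : G ⧸ H)}
  have hA : A.Finite := (hH.finite_orbit g⁻¹).image _
  -- As `H` fixes `q`, the point `l • q` depends only on `lH`; the value off the cosets of `Γ` is
  -- irrelevant.
  let ψ : G ⧸ H → Y := fun y =>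
    if h : ∃ l : Γ, ((l : G) : G ⧸ H) = y then h.choose • q else q
  refine (hA.image ψ).subset ?_
  rintro _ ⟨⟨l, hl⟩, rfl⟩
  refine ⟨((l : G) : G ⧸ H), ⟨((g⁻¹ * l : G) : G ⧸ H), ⟨g⁻¹ * l * g, ?_, by simp⟩, ?_⟩, ?_⟩
  · have hl' : ((l * g : G) : G ⧸ H) = (g : G ⧸ H) := hl
    have := QuotientGroup.eq.1 hl'.symm
    simpa [mul_assoc] using this
  · change ((g * (g⁻¹ * l) : G) : G ⧸ H) = _
    simp
  · have h : ∃ l' : Γ, ((l' : G) : G ⧸ H) = ((l : G) : G ⧸ H) := ⟨l, rfl⟩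
    have hs := QuotientGroup.eq.1 h.choose_spec
    simp only [ψ, dif_pos h]
    have := hq (h.choose⁻¹ * l) (Subgroup.mem_subgroupOf.2 (by simpa using hs))
    rw [mul_smul, inv_smul_eq_iff] at this
    exact this.symm

/-- Continuous functions on a compact `Γ`-space pull back along equivariant maps to bounded
uniformly continuous functions, when `Γ` is open. -/
theorem isBoundedUniform_comp {G X Y : Type*} [Group G] [TopologicalSpace G]
    [MulAction G X] [TopologicalSpace Y] [CompactSpace Y] {Γ : Subgroup G}
    (hΓ : IsOpen (Γ : Set G)) [MulAction Γ Y] [ContinuousSMul Γ Y] {φ : X → Y}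
    (hφ : ∀ (g : Γ) (x : X), φ (g • x) = g • φ x) {b : Y → ℝ} (hb : Continuous b) :
    IsBoundedUniform G fun x => b (φ x) := by
  constructor
  · obtain ⟨C, hC⟩ := isCompact_univ.exists_bound_of_continuousOn hb.continuousOn
    exact ⟨C, fun x => hC _ (Set.mem_univ _)⟩
  · intro ε hε
    -- Joint continuity of the action and compactness of `Y` give uniformity in `y`.
    have hu : ∀ᶠ γ in 𝓝 (1 : Γ), ∀ y ∈ (Set.univ : Set Y), |b (γ • y) - b y| < ε := by
      refine isCompact_univ.eventually_forall_of_forall_eventually fun y _ => ?_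
      have hc : Continuous fun p : Γ × Y => |b (p.1 • p.2) - b p.2| := by fun_prop
      exact hc.continuousAt.eventually_lt continuousAt_const (by simpa using hε)
    have hmap := hΓ.isOpenEmbedding_subtypeVal.map_nhds_eq (1 : Γ)
    change ∀ᶠ g in 𝓝 ((1 : Γ) : G), _
    rw [← hmap, eventually_map]
    filter_upwards [hu] with γ hγ x
    have := hγ (φ x) (Set.mem_univ _)
    rwa [← hφ] at this

/-- Amenability is assumed for spaces in the universe of `G` only, and concluded for spaces in an
arbitrary universe, so the statement covers every choice of universe at or above that of `G`. -/
theorem mainTheorem1 {G : Type u} [Group G] [TopologicalSpace G] [IsTopologicalGroup G]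
    [LocallyCompactSpace G] (H : Subgroup G) (hGH : IsDiscreteHeckePair H)
    (Γ : Subgroup G) (hΓ : IsClosed (Γ : Set G)) (hHΓ : H ≤ Γ)
    (hamen : IsAmenablePair.{u, u} H) :
    IsAmenablePair.{u, v} (H.subgroupOf Γ) := by
  intro E _ _ _ _ _ _ _ Q hQ hQc _ _ hA ⟨q₀, hq₀⟩
  have : CompactSpace Q := isCompact_iff_compactSpace.1 hQ
  have hΓo : IsOpen (Γ : Set G) := Subgroup.isOpen_mono hHΓ hGH.isOpen
  obtain ⟨φ, hφ⟩ := exists_equivariant_map (Γ := Γ) (X := G ⧸ H) (Y := Q) fun x =>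
    hA.exists_fixed_of_finite_orbit hQc _ q₀ (hGH.isHecke.finite_stabilizer_orbit hq₀ x)
  obtain ⟨m, hm, hinv⟩ := hamen.exists_invariant_mean
  obtain ⟨q, hq⟩ := exists_barycentre hQ hQc φ hm
  refine ⟨q, fun γ => Subtype.ext ?_⟩
  by_contra hne
  -- Both `a` and `a ∘ γ` are continuous and affine on `Q`, so the barycentre evaluates them as `m
  -- f` and `m (f.translate γ)`, which agree by invariance.
  obtain ⟨a, ha⟩ := SeparatingDual.exists_separating_of_ne (R := ℝ) hne
  have hc : Continuous fun y : Q => a (y : E) := by fun_prop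
  have hcγ : Continuous fun y : Q => a ((γ • y : Q) : E) :=
    hc.comp (continuous_const_smul γ)
  let f : BoundedUniform G (G ⧸ H) := ⟨_, isBoundedUniform_comp hΓo hφ hc⟩
  have h₁ : m f = a q := by
    refine hq _ hc (fun x y z s t _ _ _ h => ?_) f fun x => rfl
    simp [h]
  have h₂ : m (f.translate γ) = a ((γ • q : Q) : E) := by
    refine hq _ hcγ (fun x y z s t hs ht hst h => ?_) _ fun x => ?_
    · simp [hA γ x y z s t hs ht hst h]
    · exact congrArg (fun y : Q => a (y : E)) (hφ γ x)
  exact ha (by rw [← h₁, ← h₂, hinv])
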